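/- Let $E$ be a finite-dimensional real vector space and $B$ a symmetric bilinear form on $E$. Let $\operatorname{Ker}(B)=\{v\in E : B(v,w)=0 \text{ for all } w\in E\}$ and $r=\dim\operatorname{Ker}(B)$; let $p$ (respectively $q$) be the maximal dimension of a subspace $U$ of $E$ such that $B(u,u)>0$ (respectively $B(u,u)<0$) for all $u\in U$, $u\neq 0$. The triple $(p,q,r)$ is the signature of $B$. Let $$\operatorname{Of}(B)=\{g\in\operatorname{GL}(E) : B(gv,gw)=B(v,w)\ \text{for all } v,w\in E,\ \text{and } gv=v\ \text{for all } v\in\operatorname{Ker}(B)\},$$ and let $\mathfrak{of}(B)$ be its (real) Lie algebra, that is, the Lie subalgebra of $\operatorname{End}(E)$ of all $X$ such that $\exp(tX)\in\operatorname{Of}(B)$ for all $t\in\mathbb{R}$. Assume that $p+q\geq 2$ and that $(p,q,r)\notin\{(4,0,0),(2,2,0),(0,4,0)\}$. Then the Lie algebra $\mathfrak{of}(B)$ is indecomposable: it is nonzero and, for every isomorphism of real Lie algebras from $\mathfrak{of}(B)$ onto a product $\mathfrak{a}\times\mathfrak{b}$, one of $\mathfrak{a},\mathfrak{b}$ is zero.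 -/

import Mathlib

noncomputable section

namespace OfB

universe u v

/-- A real Lie algebra `L` is *indecomposable* if it is nonzero and if, for every isomorphism of `L`
with a product `𝔞 × 𝔟` of Lie algebras, one of `𝔞`, `𝔟` is zero.  (Both factors of such a product
embed into `L`, so letting them range over the universe of `L` is no restriction.) -/
def IsIndecomposable (L : Type v) [LieRing L] [LieAlgebra ℝ L] : Prop :=
  Nontrivial L ∧
    ∀ (𝔞 𝔟 : Type v) [LieRing 𝔞] [LieAlgebra ℝ 𝔞] [LieRing 𝔟] [LieAlgebra ℝ 𝔟],
      (L ≃ₗ⁅ℝ⁆ 𝔞 × 𝔟) → Subsingleton 𝔞 ∨ Subsingleton 𝔟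

variable {E : Type u} [AddCommGroup E] [Module ℝ E]

/-- The signature `(p, q, r)` of a real bilinear form: `p` (resp. `q`) is the maximal dimension of a
subspace on which `v ↦ B v v` is positive (resp. negative) definite, and `r` is the dimension of the
kernel `{v | ∀ w, B v w = 0}`. -/
def signature (B : LinearMap.BilinForm ℝ E) : ℕ × ℕ × ℕ :=
  (sigPos B.toQuadraticMap, sigNeg B.toQuadraticMap,
    Module.finrank ℝ (LinearMap.ker B))

/-- The group `Of(B)` of all `g ∈ GL(E)` which preserve `B` and fix each vector of `Ker B`. -/
def Of (B : LinearMap.BilinForm ℝ E) : Subgroup (LinearMap.GeneralLinearGroup ℝ E) where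
  carrier := {g | (∀ v w, B (g.1 v) (g.1 w) = B v w) ∧ ∀ v ∈ LinearMap.ker B, g.1 v = v}
  one_mem' := by simp
  mul_mem' := by
    rintro g h ⟨hg, hg'⟩ ⟨hh, hh'⟩
    refine ⟨fun v w => ?_, fun v hv => ?_⟩
    · simp [hg, hh]
    · simp [hh' v hv, hg' v hv]
  inv_mem' := by
    rintro g ⟨hg, hg'⟩
    have key : ∀ v, g.1 (g⁻¹.1 v) = v := fun v => by
      rw [← Module.End.mul_apply]; simp
    have key' : ∀ v, g⁻¹.1 (g.1 v) = v := fun v => by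
      rw [← Module.End.mul_apply]; simp
    refine ⟨fun v w => ?_, fun v hv => ?_⟩
    · rw [← hg, key, key]
    · conv_lhs => rw [← hg' v hv]
      exact key' v

variable [FiniteDimensional ℝ E]

/-- The exponential `∑ Xⁿ / n!` of an endomorphism of a finite-dimensional real vector space, with
respect to the canonical topology of the finite-dimensional real algebra `End E`. -/
def linExp (X : Module.End ℝ E) : Module.End ℝ E :=
  letI : TopologicalSpace (Module.End ℝ E) := moduleTopology ℝ (Module.End ℝ E)
  haveI : IsModuleTopology ℝ (Module.End ℝ E) := ⟨rfl⟩
  haveI : IsTopologicalRing (Module.End ℝ E) :=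
    IsModuleTopology.isTopologicalRing ℝ (Module.End ℝ E)
  NormedSpace.exp X

/-- The Lie algebra, as a set of endomorphisms of `E`, of a (closed) subgroup `G` of `GL(E)`: all `X`
whose one-parameter group `t ↦ exp (t X)` lies in `G`. -/
def lieSet (G : Subgroup (LinearMap.GeneralLinearGroup ℝ E)) : Set (Module.End ℝ E) :=
  {X | ∀ t : ℝ, ∃ g ∈ G, (g : Module.End ℝ E) = linExp (t • X)}

section Helpers

theorem map_linExp {A : Type*} [NormedRing A] [NormedAlgebra ℝ A] (e : Module.End ℝ E ≃ₐ[ℝ] A)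
    (X : Module.End ℝ E) : e (linExp X) = NormedSpace.exp (e X) := by
  have : FiniteDimensional ℝ A := e.toLinearEquiv.finiteDimensional
  let : TopologicalSpace (Module.End ℝ E) := moduleTopology ℝ (Module.End ℝ E)
  have : IsModuleTopology ℝ (Module.End ℝ E) := ⟨rfl⟩
  have : IsTopologicalRing (Module.End ℝ E) :=
    IsModuleTopology.isTopologicalRing ℝ (Module.End ℝ E)
  have : ContinuousSMul ℝ (Module.End ℝ E) := ModuleTopology.continuousSMul ℝ _
  have hc : Continuous e := IsModuleTopology.continuous_of_linearMap e.toLinearMap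
  have : T2Space (Module.End ℝ E) := T2Space.of_injective_continuous e.injective hc
  let e' : Module.End ℝ E ≃L[ℝ] A :=
    { e.toLinearEquiv with
      continuous_toFun := hc
      continuous_invFun := LinearMap.continuous_of_finiteDimensional e.symm.toLinearMap }
  have he : ∀ Y, e' Y = e Y := fun _ => rfl
  change e' (NormedSpace.exp X) = _
  rw [NormedSpace.exp_eq_tsum ℝ, NormedSpace.exp_eq_tsum ℝ]
  dsimp only
  rw [e'.map_tsum]
  simp [he]

theorem exists_normedAlgebra (E : Type u) [AddCommGroup E] [Module ℝ E] [FiniteDimensional ℝ E] :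
    ∃ (A : Type) (_ : NormedRing A) (_ : NormedAlgebra ℝ A),
      Nonempty (Module.End ℝ E ≃ₐ[ℝ] A) :=
  ⟨Matrix (Fin (Module.finrank ℝ E)) (Fin (Module.finrank ℝ E)) ℝ,
    Matrix.linftyOpNormedRing, Matrix.linftyOpNormedAlgebra,
    ⟨algEquivMatrix (Module.finBasis ℝ E)⟩⟩

theorem linExp_zero : linExp (0 : Module.End ℝ E) = 1 := by
  obtain ⟨A, _, _, ⟨e⟩⟩ := exists_normedAlgebra E
  apply e.injective
  rw [map_linExp]; simp

theorem linExp_neg_mul (X : Module.End ℝ E) : linExp (-X) * linExp X = 1 := by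
  obtain ⟨A, _, _, ⟨e⟩⟩ := exists_normedAlgebra E
  have : FiniteDimensional ℝ A := e.toLinearEquiv.finiteDimensional
  have : CompleteSpace A := FiniteDimensional.complete ℝ A
  let : NormedAlgebra ℚ A := NormedAlgebra.restrictScalars ℚ ℝ A
  apply e.injective
  rw [map_mul, map_linExp, map_linExp, map_neg, map_one,
    ← NormedSpace.exp_add_of_commute (Commute.refl _).neg_left]; simp

theorem hasDerivAt_linExp (ℓ : Module.End ℝ E →ₗ[ℝ] ℝ) (X : Module.End ℝ E) (t : ℝ) :
    HasDerivAt (fun s : ℝ => ℓ (linExp (s • X))) (ℓ (X * linExp (t • X))) t := by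
  obtain ⟨A, _, _, ⟨e⟩⟩ := exists_normedAlgebra E
  have : FiniteDimensional ℝ A := e.toLinearEquiv.finiteDimensional
  have : CompleteSpace A := FiniteDimensional.complete ℝ A
  have h := hasDerivAt_exp_smul_const' (𝕂 := ℝ) (e X) t
  let m := LinearMap.toContinuousLinearMap (ℓ ∘ₗ e.symm.toLinearMap)
  have h2 := m.hasFDerivAt.comp_hasDerivAt t h
  have hm : ∀ Y, m (e Y) = ℓ Y := fun Y => by simp [m]
  have hs : ∀ s : ℝ, NormedSpace.exp (s • e X) = e (linExp (s • X)) := fun s => by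
    rw [map_linExp, map_smul]
  rw [hs, ← map_mul, hm] at h2
  have h3 : (m ∘ fun u : ℝ => NormedSpace.exp (u • e X)) = fun s => ℓ (linExp (s • X)) := by
    funext s; simp only [Function.comp, hs, hm]
  rwa [h3] at h2

theorem hasSum_linExp (ℓ : Module.End ℝ E →ₗ[ℝ] ℝ) (X : Module.End ℝ E) :
    HasSum (fun n : ℕ => (n.factorial : ℝ)⁻¹ * ℓ (X ^ n)) (ℓ (linExp X)) := by
  obtain ⟨A, _, _, ⟨e⟩⟩ := exists_normedAlgebra E
  have : FiniteDimensional ℝ A := e.toLinearEquiv.finiteDimensional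
  have : CompleteSpace A := FiniteDimensional.complete ℝ A
  let m := LinearMap.toContinuousLinearMap (ℓ ∘ₗ e.symm.toLinearMap)
  have hm : ∀ Y, m (e Y) = ℓ Y := fun Y => by simp [m]
  have h := m.hasSum (NormedSpace.exp_series_hasSum_exp' (𝕂 := ℝ) (e X))
  rw [← map_linExp, hm] at h
  simpa only [map_smul, ← map_pow, hm, smul_eq_mul] using h

end Helpers

attribute [local instance 100] LieRing.ofAssociativeRing

/-- The Lie algebra of `Of(B)` consists of the `X` which are skew for `B` and vanish on `Ker B`. -/
theorem mem_lieSet_Of (B : LinearMap.BilinForm ℝ E) (X : Module.End ℝ E) :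
    X ∈ lieSet (Of B) ↔
      (∀ v w, B (X v) w + B v (X w) = 0) ∧ ∀ v ∈ LinearMap.ker B, X v = 0 := by
  constructor
  · intro h
    refine ⟨fun v w => ?_, fun v hv => ?_⟩
    · have hB : ∀ t : ℝ, B (linExp (t • X) v) w = B v (linExp (-(t • X)) w) := fun t => by
        obtain ⟨g, hg, hgt⟩ := h t
        have h1 := hg.1 v (linExp (-(t • X)) w)
        have h2 : linExp (t • X) * linExp (-(t • X)) = 1 := by
          simpa using linExp_neg_mul (-(t • X))
        rw [hgt, ← Module.End.mul_apply, h2] at h1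
        exact h1
      have d1 : HasDerivAt (fun s : ℝ => B (linExp (s • X) v) w)
          (B ((X * linExp ((0 : ℝ) • X)) v) w) 0 :=
        hasDerivAt_linExp ((B.flip w) ∘ₗ (LinearMap.applyₗ v)) X 0
      have d2 : HasDerivAt (fun s : ℝ => B v (linExp (s • -X) w))
          (B v ((-X * linExp ((0 : ℝ) • -X)) w)) 0 :=
        hasDerivAt_linExp ((B v) ∘ₗ (LinearMap.applyₗ w)) (-X) 0
      simp only [hB, ← smul_neg] at d1
      have h3 := d1.unique d2
      simp only [zero_smul, linExp_zero, mul_one, LinearMap.neg_apply, map_neg] at h3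
      linarith
    · rw [← Module.forall_dual_apply_eq_zero_iff ℝ]
      intro φ
      have d1 := hasDerivAt_linExp (φ ∘ₗ (LinearMap.applyₗ v)) X 0
      have hc : ∀ t : ℝ, linExp (t • X) v = v := fun t => by
        obtain ⟨g, hg, hgt⟩ := h t
        rw [← hgt]; exact hg.2 v hv
      simp only [zero_smul, linExp_zero, mul_one, LinearMap.comp_apply,
        LinearMap.applyₗ_apply_apply, hc] at d1
      exact d1.unique (hasDerivAt_const _ _)
  · rintro ⟨h1, h2⟩ t
    have e1 : linExp (t • X) * linExp (-(t • X)) = 1 := by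
      simpa using linExp_neg_mul (-(t • X))
    refine ⟨⟨linExp (t • X), linExp (-(t • X)), e1, linExp_neg_mul _⟩, ⟨?_, ?_⟩, rfl⟩
    · intro v w
      change B (linExp (t • X) v) (linExp (t • X) w) = B v w
      have key : ∀ u, B (linExp (t • X) v) u = B v (linExp (-(t • X)) u) := fun u => by
        have s1 := hasSum_linExp ((B.flip u) ∘ₗ (LinearMap.applyₗ v)) (t • X)
        have s2 := hasSum_linExp ((B v) ∘ₗ (LinearMap.applyₗ u)) (-(t • X))
        have hpow : ∀ (n : ℕ) (x : E), B (((t • X) ^ n) x) u = B x (((-(t • X)) ^ n) u) := by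
          intro n
          induction n with
          | zero => simp
          | succ n ih =>
            intro x
            have h3 := h1 x (((-(t • X)) ^ n) u)
            rw [pow_succ, pow_succ', Module.End.mul_apply, Module.End.mul_apply, ih]
            simp only [LinearMap.neg_apply, LinearMap.smul_apply, map_smul, map_neg, smul_eq_mul]
            linear_combination t * h3
        refine HasSum.unique (f := fun n : ℕ => (n.factorial : ℝ)⁻¹ * B (((t • X) ^ n) v) u) s1 ?_
        simp only [hpow]
        exact s2
      rw [key, ← Module.End.mul_apply, linExp_neg_mul]
      rfl
    · intro v hv
      change linExp (t • X) v = v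
      rw [← sub_eq_zero, ← Module.forall_dual_apply_eq_zero_iff ℝ]
      intro φ
      rw [map_sub, sub_eq_zero]
      have s1 := hasSum_linExp (φ ∘ₗ (LinearMap.applyₗ v)) (t • X)
      refine s1.unique ?_
      convert hasSum_single 0 ?_ using 1
      · simp
      · intro n hn
        obtain ⟨k, rfl⟩ := Nat.exists_eq_succ_of_ne_zero hn
        simp [pow_succ, h2 v hv]

/-- The real Lie algebra `𝔬𝔣(B)` of the group `Of(B)`, with the commutator bracket of `End E`. -/
def of (B : LinearMap.BilinForm ℝ E) : LieSubalgebra ℝ (Module.End ℝ E) where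
  carrier := lieSet (Of B)
  zero_mem' := by rw [mem_lieSet_Of]; simp
  add_mem' := by
    intro X Y hX hY
    rw [mem_lieSet_Of] at *
    refine ⟨fun v w => ?_, fun v hv => by simp [hX.2 v hv, hY.2 v hv]⟩
    have h1 := hX.1 v w
    have h2 := hY.1 v w
    simp only [LinearMap.add_apply, map_add]
    linarith
  smul_mem' := by
    intro c X hX
    rw [mem_lieSet_Of] at *
    refine ⟨fun v w => ?_, fun v hv => by simp [hX.2 v hv]⟩
    have h1 := hX.1 v w
    simp only [LinearMap.smul_apply, map_smul, smul_eq_mul]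
    rw [← mul_add, h1, mul_zero]
  lie_mem' := by
    intro X Y hX hY
    change X ∈ lieSet (Of B) at hX
    change Y ∈ lieSet (Of B) at hY
    change ⁅X, Y⁆ ∈ lieSet (Of B)
    rw [mem_lieSet_Of] at *
    refine ⟨fun v w => ?_, fun v hv => ?_⟩
    · have h1 := hX.1 (Y v) w
      have h2 := hY.1 (X v) w
      have h3 := hX.1 v (Y w)
      have h4 := hY.1 v (X w)
      simp only [LieRing.of_associative_ring_bracket, LinearMap.sub_apply, Module.End.mul_apply,
        map_sub]
      linarith
    · simp [LieRing.of_associative_ring_bracket, hX.2 v hv, hY.2 v hv]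

end OfB

end

noncomputable section

namespace OfB

open Module

attribute [local instance 100] LieRing.ofAssociativeRing

universe u

variable {E : Type u} [AddCommGroup E] [Module ℝ E]

/-! A decomposition into two ideals gives a projection `P` that is idempotent and commutes with all
brackets, so it suffices that the centroid of `of B` has no idempotents but 0 and 1
(`isIndecomposable_of_centroid`).

Fix a `B`-orthogonal basis. The coefficients B(X bᵢ, bⱼ) determine X modulo the ideal of
endomorphisms with values in Ker B, and P preserves this ideal (`coeff_centroid_eq_zero`). Modulo
it, the bᵢ ∧ bⱼ with nonisotropic indices span. Since P(bᵢ ∧ bⱼ) commutes with everything that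
commutes with bᵢ ∧ bⱼ, most of its coefficients vanish, and the rotation relations between wedges
make the surviving factor independent of the pair. Hence P is a scalar a modulo the ideal
(`exists_coeff_centroid`).

The one obstruction is a Hodge star component, possible only for a nondegenerate form in dimension
four. There idempotence would force the square of a real number to be a quarter of the discriminant.
The excluded signatures are those of positive discriminant, so the component vanishes
(`coeff_centroid_wedgeOf_opposite`).

Idempotence gives a = 0 or a = 1. Applied to P or 1 - P, `centroid_eq_zero_of_coeff` removes the
part with values in the kernel. -/

/-- The endomorphism `w ↦ B(u, w) v - B(v, w) u`. -/
def wedge (B : LinearMap.BilinForm ℝ E) (u v : E) : Module.End ℝ E :=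
  (B u).smulRight v - (B v).smulRight u

@[simp]
theorem wedge_apply (B : LinearMap.BilinForm ℝ E) (u v w : E) :
    wedge B u v w = B u w • v - B v w • u := rfl

variable [FiniteDimensional ℝ E] {B : LinearMap.BilinForm ℝ E}

theorem skew (X : of B) (v w : E) : B (X.1 v) w = -B v (X.1 w) :=
  eq_neg_of_add_eq_zero_left (((mem_lieSet_Of B X.1).1 X.2).1 v w)

theorem apply_ker (X : of B) {v : E} (hv : v ∈ LinearMap.ker B) : X.1 v = 0 :=
  ((mem_lieSet_Of B X.1).1 X.2).2 v hv

theorem lie_val_apply (X Y : of B) (v : E) : (⁅X, Y⁆ : of B).1 v = X.1 (Y.1 v) - Y.1 (X.1 v) := rfl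

/-! ### Wedges, coefficients and their brackets -/

section Wedge

variable (hB : B.IsSymm)

/-- `wedge B u v` as an element of `𝔬𝔣(B)`. -/
def wedgeOf (u v : E) : of B :=
  ⟨wedge B u v, (mem_lieSet_Of B _).2 ⟨fun x y => by
    simp only [wedge_apply, map_sub, map_smul, LinearMap.sub_apply, LinearMap.smul_apply,
      smul_eq_mul]
    rw [hB.eq u x, hB.eq v x]
    ring, fun x hx => by
    have h : ∀ z, B z x = 0 := fun z => by
      rw [← hB.eq x z, LinearMap.mem_ker.1 hx]; rfl
    simp [h]⟩⟩

theorem wedgeOf_val_apply (u v w : E) : (wedgeOf hB u v).1 w = B u w • v - B v w • u := rfl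

theorem lie_wedgeOf (X : of B) (u v : E) :
    ⁅X, wedgeOf hB u v⁆ = wedgeOf hB (X.1 u) v + wedgeOf hB u (X.1 v) := by
  refine Subtype.ext (LinearMap.ext fun w => ?_)
  rw [lie_val_apply]
  change _ = (wedgeOf hB (X.1 u) v).1 w + (wedgeOf hB u (X.1 v)).1 w
  simp only [wedgeOf_val_apply, map_sub, map_smul, skew X, neg_smul]
  abel

theorem wedgeOf_swap (u v : E) : wedgeOf hB v u = -wedgeOf hB u v := by
  refine Subtype.ext (LinearMap.ext fun w => ?_)
  change (wedgeOf hB v u).1 w = -(wedgeOf hB u v).1 w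
  simp only [wedgeOf_val_apply, neg_sub]

/-- The value `B(X bᵢ, bⱼ)`, as a linear function of `X ∈ 𝔬𝔣(B)`. -/
def coeff {ι : Type*} (b : ι → E) (i j : ι) : of B →ₗ[ℝ] ℝ where
  toFun X := B (X.1 (b i)) (b j)
  map_add' X Y := by
    change B (X.1 (b i) + Y.1 (b i)) (b j) = _
    simp
  map_smul' c X := by
    change B (c • X.1 (b i)) (b j) = _
    simp

theorem coeff_apply {ι : Type*} (b : ι → E) (i j : ι) (X : of B) :
    coeff b i j X = B (X.1 (b i)) (b j) := rfl

include hB in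
theorem coeff_swap {ι : Type*} (b : ι → E) (i j : ι) (X : of B) :
    coeff b j i X = -coeff b i j X := by
  rw [coeff_apply, coeff_apply, skew, hB.eq]

include hB in
theorem coeff_self {ι : Type*} (b : ι → E) (i : ι) (X : of B) : coeff b i i X = 0 := by
  have := coeff_swap hB b i i X
  linarith

section Basis

variable {ι : Type*} {b : Basis ι ℝ E}

omit [FiniteDimensional ℝ E] in
theorem mem_ker_of_basis {v : E} (h : ∀ i, B v (b i) = 0) : v ∈ LinearMap.ker B :=
  LinearMap.mem_ker.2 (b.ext fun i => by simpa using h i)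

theorem apply_mem_ker {X : of B} (h : ∀ i j, coeff b i j X = 0) (v : E) :
    X.1 v ∈ LinearMap.ker B := by
  have : B ∘ₗ X.1 = 0 := b.ext fun i => mem_ker_of_basis (b := b) fun j => h i j
  exact LinearMap.congr_fun this v

theorem eq_zero_of_coeff (hk : LinearMap.ker B = ⊥) {X : of B} (h : ∀ i j, coeff b i j X = 0) :
    X = 0 :=
  Subtype.ext (LinearMap.ext fun v => by simpa [hk] using apply_mem_ker h v)

variable [DecidableEq ι] (hb : B.IsOrthoᵢ b)

omit [FiniteDimensional ℝ E] in
theorem ortho_apply (hb : B.IsOrthoᵢ b) (i j : ι) :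
    B (b i) (b j) = if i = j then B (b i) (b i) else 0 := by
  split_ifs with h
  · rw [h]
  · exact hb h

include hb in
theorem wedgeOf_basis (k l i : ι) : (wedgeOf hB (b k) (b l)).1 (b i) =
    (if k = i then B (b k) (b k) else 0) • b l - (if l = i then B (b l) (b l) else 0) • b k := by
  rw [wedgeOf_val_apply, ortho_apply hb k i, ortho_apply hb l i]

include hb in
theorem coeff_wedgeOf (k l i j : ι) : coeff b i j (wedgeOf hB (b k) (b l)) =
    (if k = i then B (b k) (b k) else 0) * (if l = j then B (b l) (b l) else 0) -
    (if l = i then B (b l) (b l) else 0) * (if k = j then B (b k) (b k) else 0) := by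
  rw [coeff_apply, wedgeOf_basis hB hb, map_sub, map_smul, map_smul, LinearMap.sub_apply,
    LinearMap.smul_apply, LinearMap.smul_apply, ortho_apply hb l j, ortho_apply hb k j]
  rfl

include hb in
theorem coeff_lie_wedgeOf (Y : of B) (k l i j : ι) :
    coeff b i j ⁅wedgeOf hB (b k) (b l), Y⁆ =
      -(if k = j then B (b k) (b k) else 0) * coeff b i l Y
      + (if l = j then B (b l) (b l) else 0) * coeff b i k Y
      - (if k = i then B (b k) (b k) else 0) * coeff b l j Y
      + (if l = i then B (b l) (b l) else 0) * coeff b k j Y := by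
  rw [coeff_apply, lie_val_apply, map_sub, LinearMap.sub_apply, skew, wedgeOf_basis hB hb,
    wedgeOf_basis hB hb]
  simp only [map_sub, map_smul, LinearMap.sub_apply, LinearMap.smul_apply, smul_eq_mul, coeff_apply]
  ring

include hb in
theorem lie_wedgeOf_disjoint {i j k l : ι} (hki : k ≠ i) (hkj : k ≠ j) (hli : l ≠ i)
    (hlj : l ≠ j) : ⁅wedgeOf hB (b k) (b l), wedgeOf hB (b i) (b j)⁆ = 0 := by
  rw [lie_wedgeOf, wedgeOf_basis hB hb, wedgeOf_basis hB hb]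
  refine Subtype.ext (LinearMap.ext fun w => ?_)
  change (wedgeOf hB _ _).1 w + (wedgeOf hB _ _).1 w = 0
  simp [wedgeOf_val_apply, hki, hkj, hli, hlj]

include hb in
theorem lie_wedgeOf_adjacent {i j k : ι} (hij : i ≠ j) (hik : i ≠ k) (hjk : j ≠ k) :
    ⁅wedgeOf hB (b i) (b k), wedgeOf hB (b i) (b j)⁆ =
      -(B (b i) (b i) • wedgeOf hB (b j) (b k)) := by
  rw [lie_wedgeOf, wedgeOf_basis hB hb, wedgeOf_basis hB hb]
  refine Subtype.ext (LinearMap.ext fun w => ?_)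
  change (wedgeOf hB _ _).1 w + (wedgeOf hB _ _).1 w = -(B (b i) (b i) • (wedgeOf hB (b j) (b k)).1 w)
  simp [wedgeOf_val_apply, hij, hjk.symm, hik.symm, smul_sub, smul_smul, mul_comm]

end Basis

end Wedge

/-! ### Constraints on a centroid element -/

section Centroid

variable {ι : Type*} {b : Basis ι ℝ E}
  {P : of B →ₗ[ℝ] of B} (hB : B.IsSymm) (hb : B.IsOrthoᵢ b)
  (hP : ∀ X Y, P ⁅X, Y⁆ = ⁅P X, Y⁆)

include hP in
theorem centroid_right (X Y : of B) : P ⁅X, Y⁆ = ⁅X, P Y⁆ := by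
  rw [← lie_skew, map_neg, hP, lie_skew]

include hB hP in
/-- Elements of the centroid preserve the endomorphisms with values in the kernel of `B`. -/
theorem coeff_centroid_eq_zero {X : of B} (hX : ∀ i j, coeff b i j X = 0) (i j : ι) :
    coeff b i j (P X) = 0 := by
  by_cases hk : LinearMap.ker B = ⊥
  · simp [eq_zero_of_coeff hk hX]
  obtain ⟨k, hk, hk0⟩ := Submodule.exists_mem_ne_zero_of_ne_bot hk
  have hBk : ∀ v, B k v = 0 := fun v => by rw [LinearMap.mem_ker.1 hk]; rfl
  -- Each of the two kills the values of the other. Bracketing k ∧ bⱼ with P X instead and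
  -- evaluating at bᵢ isolates B(bⱼ, (P X) bᵢ) k.
  have h1 : ⁅X, wedgeOf hB k (b j)⁆ = 0 := by
    refine Subtype.ext (LinearMap.ext fun w => ?_)
    have h2 := apply_mem_ker hX w
    change X.1 ((wedgeOf hB k (b j)).1 w) - (wedgeOf hB k (b j)).1 (X.1 w) = 0
    rw [wedgeOf_val_apply, wedgeOf_val_apply, hBk, hBk, hB.eq (X.1 w) (b j) |>.symm,
      LinearMap.mem_ker.1 h2, zero_smul, zero_sub, map_neg, map_smul, apply_ker X hk]
    simp
  have h3 := hP X (wedgeOf hB k (b j))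
  rw [h1, map_zero] at h3
  have h4 := congrArg (fun Z : of B => Z.1 (b i)) h3.symm
  simp only [lie_val_apply, wedgeOf_val_apply, hBk, zero_smul, zero_sub, map_neg, map_smul,
    apply_ker _ hk, smul_zero, neg_zero, sub_neg_eq_add, zero_add] at h4
  have h5 : B (b j) ((P X).1 (b i)) = 0 := (smul_eq_zero.1 h4).resolve_right hk0
  rw [coeff_apply, ← h5, hB.eq]

/-- The factor by which an element of the centroid multiplies the `(i, j)` coefficient of
`bᵢ ∧ bⱼ`. -/
def ratio (b : Basis ι ℝ E) (P : of B →ₗ[ℝ] of B) (i j : ι) : ℝ :=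
  coeff b i j (P (wedgeOf hB (b i) (b j))) / (B (b i) (b i) * B (b j) (b j))

theorem ratio_comm (i j : ι) : ratio hB b P j i = ratio hB b P i j := by
  rw [ratio, wedgeOf_swap hB (b i) (b j), map_neg, map_neg, coeff_swap hB b i j, neg_neg, mul_comm,
    ratio]

variable [DecidableEq ι]

include hb hP in
-- P(bᵢ ∧ bⱼ) commutes with bᵢ ∧ bⱼ; the (m, j) coefficient of that bracket is the wanted one times
-- B(bⱼ, bⱼ).
theorem coeff_centroid_wedgeOf_mixed {i j m : ι} (hj : B (b j) (b j) ≠ 0)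
    (hmi : m ≠ i) (hmj : m ≠ j) : coeff b m i (P (wedgeOf hB (b i) (b j))) = 0 := by
  by_cases hij : i = j
  · subst hij
    have : wedgeOf hB (b i) (b i) = 0 := Subtype.ext (LinearMap.ext fun w => sub_self _)
    simp [this]
  have h := coeff_lie_wedgeOf hB hb (P (wedgeOf hB (b i) (b j))) i j m j
  rw [← centroid_right hP, lie_self] at h
  simpa [hij, hmi.symm, hmj.symm, hj] using h

include hb hP in
-- For k in the kernel, bₘ ∧ k commutes with bᵢ ∧ bⱼ, hence with its image under P; evaluating this
-- bracket at bₙ gives the coefficient times k.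
theorem coeff_centroid_wedgeOf_of_ker (hk : LinearMap.ker B ≠ ⊥) {i j m : ι}
    (hmi : m ≠ i) (hmj : m ≠ j) (n : ι) : coeff b m n (P (wedgeOf hB (b i) (b j))) = 0 := by
  obtain ⟨k, hk, hk0⟩ := Submodule.exists_mem_ne_zero_of_ne_bot hk
  have hBk : ∀ v, B v k = 0 := fun v => by rw [hB.eq k v |>.symm, LinearMap.mem_ker.1 hk]; rfl
  have h1 : ⁅wedgeOf hB (b i) (b j), wedgeOf hB (b m) k⁆ = 0 := by
    rw [lie_wedgeOf, wedgeOf_basis hB hb, apply_ker _ hk]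
    refine Subtype.ext (LinearMap.ext fun w => ?_)
    change (wedgeOf hB _ _).1 w + (wedgeOf hB _ _).1 w = 0
    simp [wedgeOf_val_apply, hmi.symm, hmj.symm]
  have h3 := hP (wedgeOf hB (b i) (b j)) (wedgeOf hB (b m) k)
  rw [h1, map_zero, lie_wedgeOf, apply_ker _ hk] at h3
  have h4 := congrArg (fun Z : of B => Z.1 (b n)) h3.symm
  change (wedgeOf hB _ _).1 _ + (wedgeOf hB _ _).1 _ = 0 at h4
  simp only [wedgeOf_val_apply, LinearMap.mem_ker.1 hk, LinearMap.zero_apply, zero_smul, sub_zero,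
    map_zero, smul_zero, add_zero] at h4
  exact (smul_eq_zero.1 h4).resolve_right hk0

include hb hP in
-- A fifth, nonisotropic index l plays the role of the kernel vector: bₘ ∧ bₗ commutes with bᵢ ∧ bⱼ,
-- and the (n, l) coefficient is read off.
theorem coeff_centroid_wedgeOf_of_exists {i j m n l : ι} (hl : B (b l) (b l) ≠ 0)
    (hmi : m ≠ i) (hmj : m ≠ j) (hli : l ≠ i) (hlj : l ≠ j) (hlm : l ≠ m) (hln : l ≠ n) :
    coeff b n m (P (wedgeOf hB (b i) (b j))) = 0 := by
  by_cases hmn : m = n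
  · rw [hmn, coeff_self hB]
  have h := coeff_lie_wedgeOf hB hb (P (wedgeOf hB (b i) (b j))) m l n l
  rw [← centroid_right hP, lie_wedgeOf_disjoint hB hb hmi hmj hli hlj] at h
  simpa [hlm.symm, hln, hmn, hl] using h

include hb hP in
theorem centroid_wedgeOf_rotate {i j k : ι} (hij : i ≠ j) (hik : i ≠ k) (hjk : j ≠ k) :
    B (b i) (b i) • P (wedgeOf hB (b j) (b k)) =
      -⁅wedgeOf hB (b i) (b k), P (wedgeOf hB (b i) (b j))⁆ := by
  rw [← centroid_right hP, lie_wedgeOf_adjacent hB hb hij hik hjk, map_neg, map_smul, neg_neg]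

include hb hP in
theorem coeff_centroid_wedgeOf_rotate {i j k : ι} (hij : i ≠ j) (hik : i ≠ k) (hjk : j ≠ k) :
    B (b i) (b i) * coeff b j k (P (wedgeOf hB (b j) (b k))) =
      B (b k) (b k) * coeff b i j (P (wedgeOf hB (b i) (b j))) := by
  have h := congrArg (coeff b j k) (centroid_wedgeOf_rotate hB hb hP hij hik hjk)
  rw [map_smul, map_neg, coeff_lie_wedgeOf hB hb] at h
  simp only [hij, hik, hjk.symm, if_true, if_false, smul_eq_mul] at h
  rw [h, coeff_swap hB b i j]
  ring

include hb hP in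
-- Two such rotations carry the Hodge star component of P(bᵢ ∧ bⱼ) to that of the complementary
-- wedge.
theorem coeff_centroid_wedgeOf_rotate_opposite {i j k l : ι} (hi : B (b i) (b i) ≠ 0)
    (hij : i ≠ j) (hik : i ≠ k) (hjk : j ≠ k) (hli : l ≠ i) (hlk : l ≠ k) :
    coeff b i l (P (wedgeOf hB (b j) (b k))) = coeff b k l (P (wedgeOf hB (b i) (b j))) := by
  have h := congrArg (coeff b i l) (centroid_wedgeOf_rotate hB hb hP hij hik hjk)
  rw [map_smul, map_neg, coeff_lie_wedgeOf hB hb] at h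
  simpa [hik.symm, hli.symm, hlk.symm, hi] using h

include hb hP in
theorem ratio_rotate {i j k : ι} (hi : B (b i) (b i) ≠ 0) (hj : B (b j) (b j) ≠ 0)
    (hk : B (b k) (b k) ≠ 0) (hij : i ≠ j) (hik : i ≠ k) (hjk : j ≠ k) :
    ratio hB b P j k = ratio hB b P i j := by
  have h := coeff_centroid_wedgeOf_rotate hB hb hP hij hik hjk
  rw [ratio, ratio, div_eq_div_iff (by positivity) (by positivity)]
  linear_combination B (b j) (b j) * h

include hb hP in
theorem ratio_eq {i j k l : ι} (hi : B (b i) (b i) ≠ 0) (hj : B (b j) (b j) ≠ 0)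
    (hk : B (b k) (b k) ≠ 0) (hl : B (b l) (b l) ≠ 0) (hij : i ≠ j) (hkl : k ≠ l) :
    ratio hB b P i j = ratio hB b P k l := by
  have key : ∀ {x y z : ι}, B (b x) (b x) ≠ 0 → B (b y) (b y) ≠ 0 → B (b z) (b z) ≠ 0 →
      x ≠ y → x ≠ z → ratio hB b P x y = ratio hB b P x z := by
    intro x y z hx hy hz hxy hxz
    by_cases hyz : y = z
    · rw [hyz]
    · rw [← ratio_comm, ← ratio_rotate hB hb hP hy hx hz hxy.symm hyz hxz]
  by_cases hik : i = k
  · subst hik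
    exact key hi hj hl hij hkl
  · rw [key hi hj hk hij hik, ← ratio_comm]
    exact key hk hi hl (Ne.symm hik) hkl

end Centroid

/-! ### Idempotents of the centroid are 0 or 1 -/

section Scalar

variable {ι : Type*} [Fintype ι] [DecidableEq ι] {b : Basis ι ℝ E}
  {P : of B →ₗ[ℝ] of B} (hB : B.IsSymm) (hb : B.IsOrthoᵢ b)
  (hP : ∀ X Y, P ⁅X, Y⁆ = ⁅P X, Y⁆) (hPP : ∀ X, P (P X) = P X)

omit [FiniteDimensional ℝ E] in
include hb in
theorem ker_eq_bot_of_ortho (h : ∀ i, B (b i) (b i) ≠ 0) : LinearMap.ker B = ⊥ := by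
  rw [LinearMap.ker_eq_bot']
  intro v hv
  refine b.repr.map_eq_zero_iff.1 (Finsupp.ext fun i => ?_)
  have h1 : B v (b i) = 0 := by rw [hv]; rfl
  rw [← b.sum_repr v, map_sum, LinearMap.sum_apply] at h1
  simp only [map_smul, LinearMap.smul_apply, smul_eq_mul, ortho_apply hb _ i] at h1
  rw [Finset.sum_eq_single i (fun j _ hj => by simp [hj]) (by simp), if_pos rfl] at h1
  exact (mul_eq_zero.1 h1).resolve_right (h i)

include hb hP hPP in
/-- In dimension four, when the discriminant is negative, an idempotent of the centroid does not
involve the Hodge star. -/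
theorem coeff_centroid_wedgeOf_opposite {i j k l : ι} (h0 : ∀ x, B (b x) (b x) ≠ 0)
    (hij : i ≠ j) (hki : k ≠ i) (hkj : k ≠ j) (hli : l ≠ i) (hlj : l ≠ j) (hkl : k ≠ l)
    (hall : ∀ x, x = i ∨ x = j ∨ x = k ∨ x = l)
    (hneg : B (b i) (b i) * B (b j) (b j) * (B (b k) (b k) * B (b l) (b l)) < 0) :
    coeff b k l (P (wedgeOf hB (b i) (b j))) = 0 := by
  have hopp : coeff b i j (P (wedgeOf hB (b k) (b l))) =
      coeff b k l (P (wedgeOf hB (b i) (b j))) := by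
    rw [← coeff_centroid_wedgeOf_rotate_opposite hB hb hP (h0 i) hij hki.symm hkj.symm hli hkl.symm,
      coeff_swap hB b l i, ← coeff_centroid_wedgeOf_rotate_opposite hB hb hP (h0 j) hkj.symm hlj.symm
      hkl hij hli.symm, coeff_swap hB b j i]
  set a := ratio hB b P i j with ha
  have ha' : ratio hB b P k l = a := ratio_eq hB hb hP (h0 k) (h0 l) (h0 i) (h0 j) hkl hij
  set β := coeff b k l (P (wedgeOf hB (b i) (b j))) with hβ
  set c := β / (B (b k) (b k) * B (b l) (b l)) with hc
  have hi := h0 i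
  have hj := h0 j
  have hk := h0 k
  have hl := h0 l
  have hcβ : c * (B (b k) (b k) * B (b l) (b l)) = β := by rw [hc]; field_simp
  have haij : coeff b i j (P (wedgeOf hB (b i) (b j))) = a * (B (b i) (b i) * B (b j) (b j)) := by
    rw [ha, ratio]; field_simp
  have hakl : coeff b k l (P (wedgeOf hB (b k) (b l))) = a * (B (b k) (b k) * B (b l) (b l)) := by
    rw [← ha', ratio]; field_simp
  -- Here c is the coefficient of the Hodge star part; all mixed coefficients vanish.
  have hexp : P (wedgeOf hB (b i) (b j)) =
      a • wedgeOf hB (b i) (b j) + c • wedgeOf hB (b k) (b l) := by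
    rw [← sub_eq_zero]
    refine eq_zero_of_coeff (b := b) (ker_eq_bot_of_ortho hb h0) ?_
    have hmi : ∀ {m}, m ≠ i → m ≠ j → coeff b m i (P (wedgeOf hB (b i) (b j))) = 0 :=
      fun h1 h2 => coeff_centroid_wedgeOf_mixed hB hb hP hj h1 h2
    have hmj : ∀ {m}, m ≠ i → m ≠ j → coeff b m j (P (wedgeOf hB (b i) (b j))) = 0 :=
      fun h1 h2 => by
        rw [wedgeOf_swap hB (b j) (b i), map_neg, map_neg,
          coeff_centroid_wedgeOf_mixed hB hb hP hi h2 h1, neg_zero]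
    have hswap : ∀ x y, coeff b x y (P (wedgeOf hB (b i) (b j)) -
        (a • wedgeOf hB (b i) (b j) + c • wedgeOf hB (b k) (b l))) = 0 →
        coeff b y x (P (wedgeOf hB (b i) (b j)) -
        (a • wedgeOf hB (b i) (b j) + c • wedgeOf hB (b k) (b l))) = 0 := fun x y h => by
      rw [coeff_swap hB b x y, h, neg_zero]
    have h1 := coeff_self hB b
    -- One ordering of each pair of indices; skew-symmetry supplies the other.
    have hpairs : ∀ x y, (x = i ∧ y = j) ∨ (x = k ∧ y = l) ∨
        ((x = k ∨ x = l) ∧ (y = i ∨ y = j)) ∨ x = y → coeff b x y (P (wedgeOf hB (b i) (b j)) -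
        (a • wedgeOf hB (b i) (b j) + c • wedgeOf hB (b k) (b l))) = 0 := by
      intro x y hxy
      simp only [map_sub, map_add, map_smul, smul_eq_mul, coeff_wedgeOf hB hb]
      rcases hxy with ⟨rfl, rfl⟩ | ⟨rfl, rfl⟩ | ⟨rfl | rfl, rfl | rfl⟩ | rfl
      · simp [haij, hki, hli, hij.symm]
      · simp [← hβ, hki.symm, hkj.symm, hcβ, hkl.symm]
      · simp [hmi hki hkj, hki.symm, hkj.symm, hki, hli]
      · simp [hmj hki hkj, hki.symm, hkj.symm, hkj, hlj]
      · simp [hmi hli hlj, hli.symm, hlj.symm, hki, hli]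
      · simp [hmj hli hlj, hli.symm, hlj.symm, hkj, hlj]
      · simp only [h1]; ring
    intro x y
    rcases hall x with hx | hx | hx | hx <;> rcases hall y with hy | hy | hy | hy <;>
    first
    | (refine hpairs x y ?_; simp [hx, hy]; done)
    | (refine hswap y x (hpairs y x ?_); simp [hx, hy])
  -- Comparing coefficients in P² = P gives β(2a - 1) = 0, so β ≠ 0 forces a = 1/2, and then β² is a
  -- quarter of the negative discriminant.
  have hP2 := hPP (wedgeOf hB (b i) (b j))
  rw [hexp] at hP2
  have e1 := congrArg (coeff b i j) hP2
  have e2 := congrArg (coeff b k l) hP2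
  simp only [map_add, map_smul, smul_eq_mul, haij, hakl, hopp, ← hβ, coeff_wedgeOf hB hb,
    hij, hij.symm, hki, hki.symm, hkj, hkj.symm, hli, hlj, hkl, hkl.symm, hli.symm, hlj.symm,
    if_true, if_false] at e1 e2
  by_contra hβ0
  have e3 : β * (2 * a - 1) = 0 := by linear_combination e2 + (1 - a) * hcβ
  have ha2 : a = 1 / 2 := by
    have := (mul_eq_zero.1 e3).resolve_left hβ0
    linarith
  have e4 : β ^ 2 = 1 / 4 * (B (b i) (b i) * B (b j) (b j) * (B (b k) (b k) * B (b l) (b l))) := by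
    rw [ha2] at e1
    linear_combination (B (b k) (b k) * B (b l) (b l)) * e1 - β * hcβ
  nlinarith [sq_nonneg β]

include hb hP hPP in
-- Either the kernel is nonzero, or a fifth index exists, or i, j, m, n exhaust the basis and the
-- discriminant is negative.
theorem coeff_centroid_wedgeOf_compl
    (hgen : LinearMap.ker B = ⊥ → (∀ i, B (b i) (b i) ≠ 0) ∧
      (Fintype.card ι = 4 → ∏ i, B (b i) (b i) < 0)) {i j m n : ι} (hij : i ≠ j)
    (hmi : m ≠ i) (hmj : m ≠ j) (hni : n ≠ i) (hnj : n ≠ j) :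
    coeff b m n (P (wedgeOf hB (b i) (b j))) = 0 := by
  by_cases hk : LinearMap.ker B = ⊥
  swap
  · exact coeff_centroid_wedgeOf_of_ker hB hb hP hk hmi hmj n
  obtain ⟨h0, hneg⟩ := hgen hk
  by_cases hmn : m = n
  · rw [hmn, coeff_self hB]
  have hcard : ({i, j, m, n} : Finset ι).card = 4 := by
    rw [Finset.card_insert_of_notMem, Finset.card_insert_of_notMem, Finset.card_insert_of_notMem,
      Finset.card_singleton] <;> simp [hij, hmi.symm, hmj.symm, hni.symm, hnj.symm, hmn]
  by_cases hex : ∃ l, l ∉ ({i, j, m, n} : Finset ι)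
  · obtain ⟨l, hl⟩ := hex
    simp only [Finset.mem_insert, Finset.mem_singleton, not_or] at hl
    exact coeff_centroid_wedgeOf_of_exists hB hb hP (h0 l) hni hnj hl.1 hl.2.1 hl.2.2.2 hl.2.2.1
  · push Not at hex
    have huniv : Finset.univ = ({i, j, m, n} : Finset ι) :=
      (Finset.eq_univ_iff_forall.2 hex).symm
    have hneg' := hneg (by rw [← Finset.card_univ, huniv, hcard])
    rw [huniv, Finset.prod_insert, Finset.prod_insert, Finset.prod_insert, Finset.prod_singleton]
      at hneg'
    · exact coeff_centroid_wedgeOf_opposite hB hb hP hPP h0 hij hmi hmj hni hnj hmn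
        (by simpa using hex) (by linarith)
    all_goals simp [hij, hmi.symm, hmj.symm, hni.symm, hnj.symm, hmn]

include hb hP hPP in
theorem coeff_centroid_wedgeOf
    (hgen : LinearMap.ker B = ⊥ → (∀ i, B (b i) (b i) ≠ 0) ∧
      (Fintype.card ι = 4 → ∏ i, B (b i) (b i) < 0)) {i j : ι} (hij : i ≠ j)
    (hi : B (b i) (b i) ≠ 0) (hj : B (b j) (b j) ≠ 0) (x y : ι) :
    coeff b x y (P (wedgeOf hB (b i) (b j))) =
      ratio hB b P i j * coeff b x y (wedgeOf hB (b i) (b j)) := by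
  have hmi : ∀ {m}, m ≠ i → m ≠ j → coeff b m i (P (wedgeOf hB (b i) (b j))) = 0 :=
    fun h1 h2 => coeff_centroid_wedgeOf_mixed hB hb hP hj h1 h2
  have hmj : ∀ {m}, m ≠ i → m ≠ j → coeff b m j (P (wedgeOf hB (b i) (b j))) = 0 :=
    fun h1 h2 => by
      rw [wedgeOf_swap hB (b j) (b i), map_neg, map_neg,
        coeff_centroid_wedgeOf_mixed hB hb hP hi h2 h1, neg_zero]
  have haij : coeff b i j (P (wedgeOf hB (b i) (b j))) =
      ratio hB b P i j * (B (b i) (b i) * B (b j) (b j)) := by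
    rw [ratio]; field_simp
  rw [coeff_wedgeOf hB hb]
  by_cases hxi : x = i
  · subst hxi
    by_cases hyj : y = j
    · subst hyj
      simp [haij, hij.symm]
    · by_cases hyx : y = x
      · subst hyx
        rw [coeff_self hB]; ring
      · rw [coeff_swap hB b y x, hmi hyx hyj]
        simp [Ne.symm hyj, hij.symm]
  by_cases hxj : x = j
  · subst hxj
    by_cases hyi : y = i
    · subst hyi
      rw [coeff_swap hB b y x, haij]
      simp only [hij, if_true, if_false]
      ring
    · by_cases hyx : y = x
      · subst hyx
        rw [coeff_self hB]; ring
      · rw [coeff_swap hB b y x, hmj hyi hyx]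
        simp [Ne.symm hyi, hij]
  have hz : (if i = x then B (b i) (b i) else 0) = 0 := if_neg (Ne.symm hxi)
  have hz' : (if j = x then B (b j) (b j) else 0) = 0 := if_neg (Ne.symm hxj)
  rw [hz, hz']
  by_cases hyi : y = i
  · rw [hyi, hmi hxi hxj]; ring
  by_cases hyj : y = j
  · rw [hyj, hmj hxi hxj]; ring
  rw [coeff_centroid_wedgeOf_compl hB hb hP hPP hgen hij hxi hxj hyi hyj]
  ring

omit [Fintype ι] in
include hb in
theorem coeff_eq_zero_of_isotropic {x : ι} (hx : B (b x) (b x) = 0) (y : ι) (X : of B) :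
    coeff b x y X = 0 := by
  have : b x ∈ LinearMap.ker B := mem_ker_of_basis (b := b) fun j => by
    rw [ortho_apply hb, hx, ite_self]
  rw [coeff_apply, apply_ker X this, map_zero]
  rfl

include hb in
-- The 2 arises because each unordered pair occurs twice. Isotropic indices contribute nothing:
-- division by zero yields 0, and such basis vectors lie in the kernel.
theorem coeff_sum_wedgeOf (X : of B) (x y : ι) :
    coeff b x y (∑ i, ∑ j, (coeff b i j X / (B (b i) (b i) * B (b j) (b j))) •
      wedgeOf hB (b i) (b j)) = 2 * coeff b x y X := by
  by_cases hx : B (b x) (b x) = 0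
  · simp [coeff_eq_zero_of_isotropic hb hx]
  by_cases hy : B (b y) (b y) = 0
  · rw [coeff_swap hB b y x, coeff_eq_zero_of_isotropic hb hy, coeff_swap hB b y x,
      coeff_eq_zero_of_isotropic hb hy]
    simp
  simp only [map_sum, map_smul, coeff_wedgeOf hB hb, smul_eq_mul, mul_sub, Finset.sum_sub_distrib]
  simp only [ite_mul, mul_ite, zero_mul, mul_zero, Finset.sum_ite_eq',
    Finset.mem_univ, if_true]
  rw [Finset.sum_comm]
  simp only [Finset.sum_ite_eq', Finset.mem_univ, if_true]
  rw [coeff_swap hB b x y]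
  field_simp
  ring

include hB hb hP hPP in
/-- Modulo the endomorphisms with values in the kernel of `B`, an idempotent of the centroid is a
scalar. -/
theorem exists_coeff_centroid
    (hgen : LinearMap.ker B = ⊥ → (∀ i, B (b i) (b i) ≠ 0) ∧
      (Fintype.card ι = 4 → ∏ i, B (b i) (b i) < 0)) {i₀ j₀ : ι} (hij₀ : i₀ ≠ j₀)
    (hi₀ : B (b i₀) (b i₀) ≠ 0) (hj₀ : B (b j₀) (b j₀) ≠ 0) :
    ∃ a : ℝ, ∀ X x y, coeff b x y (P X) = a * coeff b x y X := by
  refine ⟨ratio hB b P i₀ j₀, fun X x y => ?_⟩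
  set a := ratio hB b P i₀ j₀
  set S := ∑ i, ∑ j, (coeff b i j X / (B (b i) (b i) * B (b j) (b j))) • wedgeOf hB (b i) (b j)
    with hS
  have hPS : coeff b x y (P S) = a * coeff b x y S := by
    rw [hS]
    simp only [map_sum, map_smul, smul_eq_mul, Finset.mul_sum]
    refine Finset.sum_congr rfl fun i _ => Finset.sum_congr rfl fun j _ => ?_
    by_cases hi : B (b i) (b i) = 0
    · simp [hi]
    by_cases hj : B (b j) (b j) = 0
    · simp [hj]
    by_cases hij : i = j
    · simp [hij, coeff_self hB]
    rw [coeff_centroid_wedgeOf hB hb hP hPP hgen hij hi hj,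
      ratio_eq hB hb hP hi hj hi₀ hj₀ hij hij₀]
    ring
  have hS2 : coeff b x y S = 2 * coeff b x y X := coeff_sum_wedgeOf hB hb X x y
  -- 2X and S agree modulo the ideal of kernel-valued endomorphisms, which P preserves.
  have hW := coeff_centroid_eq_zero hB hP (b := b) (X := (2 : ℝ) • X - S)
    (fun u v => by rw [map_sub, map_smul, coeff_sum_wedgeOf hB hb, smul_eq_mul, sub_self]) x y
  rw [map_sub, map_sub, map_smul, map_smul, smul_eq_mul, hPS, hS2] at hW
  linarith

omit [Fintype ι] in
include hB hb hP hPP in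
-- If P is kernel-valued, then [P X, P Y] = 0, yet idempotence identifies it with [P X, Y], which
-- acts as P X ∘ Y. So P X kills the image of every Y, and these images contain every bᵢ up to a
-- nonzero scalar.
theorem centroid_eq_zero_of_coeff {i₀ j₀ : ι} (hij₀ : i₀ ≠ j₀) (hi₀ : B (b i₀) (b i₀) ≠ 0)
    (hj₀ : B (b j₀) (b j₀) ≠ 0) (h : ∀ X x y, coeff b x y (P X) = 0) (X : of B) : P X = 0 := by
  have hmul : ∀ (X Y : of B) (v : E), (P X).1 (Y.1 v) = 0 := fun X Y v => by
    have h1 : ⁅P X, P Y⁆ = ⁅P X, Y⁆ := by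
      rw [← centroid_right hP, hP, hPP]
    have h2 := congrArg (fun Z : of B => Z.1 v) h1
    simp only [lie_val_apply, apply_ker _ (apply_mem_ker (h _) v)] at h2
    simpa using h2.symm
  refine Subtype.ext (b.ext fun i => ?_)
  change (P X).1 (b i) = 0
  -- bⱼ ∧ bᵢ sends bⱼ to a nonzero multiple of bᵢ; one of the two nonisotropic indices always
  -- differs from i.
  have key : ∀ j, j ≠ i → B (b j) (b j) ≠ 0 → (P X).1 (b i) = 0 := fun j hji hj => by
    have h3 := hmul X (wedgeOf hB (b j) (b i)) (b j)
    rw [wedgeOf_basis hB hb] at h3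
    simpa [hji.symm, hj] using h3
  by_cases hi : i₀ = i
  · exact key j₀ (by rw [← hi]; exact hij₀.symm) hj₀
  · exact key i₀ hi hi₀

include hB hb hP hPP in
theorem centroid_idempotent_trivial
    (hgen : LinearMap.ker B = ⊥ → (∀ i, B (b i) (b i) ≠ 0) ∧
      (Fintype.card ι = 4 → ∏ i, B (b i) (b i) < 0)) {i₀ j₀ : ι} (hij₀ : i₀ ≠ j₀)
    (hi₀ : B (b i₀) (b i₀) ≠ 0) (hj₀ : B (b j₀) (b j₀) ≠ 0) :
    (∀ X, P X = 0) ∨ ∀ X, P X = X := by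
  obtain ⟨a, ha⟩ := exists_coeff_centroid hB hb hP hPP hgen hij₀ hi₀ hj₀
  have hne : coeff b i₀ j₀ (wedgeOf hB (b i₀) (b j₀)) ≠ 0 := by
    simp [coeff_wedgeOf hB hb, hi₀, hj₀, hij₀]
  have haa : a = 0 ∨ a - 1 = 0 := by
    have h1 := ha (P (wedgeOf hB (b i₀) (b j₀))) i₀ j₀
    rw [hPP, ha] at h1
    have h2 : a * (a - 1) * coeff b i₀ j₀ (wedgeOf hB (b i₀) (b j₀)) = 0 := by linarith
    exact mul_eq_zero.1 ((mul_eq_zero.1 h2).resolve_right hne)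
  rcases haa with ha0 | ha1
  · left
    exact centroid_eq_zero_of_coeff hB hb hP hPP hij₀ hi₀ hj₀ fun X x y => by rw [ha, ha0, zero_mul]
  · right
    intro X
    have h := centroid_eq_zero_of_coeff (P := LinearMap.id - P) hB hb
      (fun X Y => by simp [hP]) (fun X => by simp [hPP]) hij₀ hi₀ hj₀
      (fun X x y => by
        rw [LinearMap.sub_apply, map_sub, ha, LinearMap.id_apply]
        linear_combination -(coeff b x y X) * ha1) X
    rw [LinearMap.sub_apply, sub_eq_zero] at h
    exact h.symm

end Scalar

/-! ### Indecomposability and signature -/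

/-- A Lie algebra whose centroid has no nontrivial idempotent is indecomposable. -/
theorem isIndecomposable_of_centroid {L : Type*} [LieRing L] [LieAlgebra ℝ L] [Nontrivial L]
    (h : ∀ P : L →ₗ[ℝ] L, (∀ X Y, P ⁅X, Y⁆ = ⁅P X, Y⁆) → (∀ X, P (P X) = P X) →
      (∀ X, P X = 0) ∨ ∀ X, P X = X) : IsIndecomposable L := by
  refine ⟨inferInstance, fun 𝔞 𝔟 _ _ _ _ e => ?_⟩
  let P : L →ₗ[ℝ] L := e.symm.toLinearEquiv.toLinearMap ∘ₗ LinearMap.inl ℝ 𝔞 𝔟 ∘ₗ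
    LinearMap.fst ℝ 𝔞 𝔟 ∘ₗ e.toLinearEquiv.toLinearMap
  have hPe : ∀ X, e (P X) = ((e X).1, 0) := fun X => e.apply_symm_apply _
  rcases h P (fun X Y => e.toLinearEquiv.injective (by
      change e (P ⁅X, Y⁆) = e ⁅P X, Y⁆
      rw [hPe, LieEquiv.map_lie, LieEquiv.map_lie, hPe]
      refine Prod.ext rfl ?_
      change 0 = ⁅(0 : 𝔟), (e Y).2⁆
      rw [zero_lie]))
    (fun X => e.toLinearEquiv.injective (by
      change e (P (P X)) = e (P X)
      rw [hPe, hPe])) with h0 | h1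
  · refine Or.inl ((subsingleton_iff_forall_eq 0).2 fun x => ?_)
    have h2 := hPe (e.symm (x, 0))
    rw [h0, map_zero, e.apply_symm_apply] at h2
    exact (congrArg Prod.fst h2).symm
  · refine Or.inr ((subsingleton_iff_forall_eq 0).2 fun y => ?_)
    have h2 := hPe (e.symm (0, y))
    rw [h1, e.apply_symm_apply] at h2
    exact congrArg Prod.snd h2

/-- A product of nonzero reals is negative when the number of negative factors is odd. -/
theorem prod_neg_of_odd {ι : Type*} [Fintype ι] {w : ι → ℝ} (h0 : ∀ i, w i ≠ 0)
    (hodd : Odd {i | w i < 0}.ncard) : ∏ i, w i < 0 := by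
  classical
  have hcard : {i | w i < 0}.ncard = (Finset.univ.filter fun i => w i < 0).card := by
    rw [← Set.ncard_coe_finset]
    simp
  rw [← Finset.prod_filter_mul_prod_filter_not Finset.univ (fun i => w i < 0)]
  refine mul_neg_of_neg_of_pos ?_ (Finset.prod_pos fun i hi => ?_)
  · have h1 : ∏ i ∈ Finset.univ.filter (fun i => w i < 0), w i =
        (-1) ^ (Finset.univ.filter fun i => w i < 0).card *
          ∏ i ∈ Finset.univ.filter (fun i => w i < 0), -w i := by
      rw [← Finset.prod_neg]
      simp
    rw [h1, Odd.neg_one_pow (hcard ▸ hodd), neg_one_mul, neg_lt_zero]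
    exact Finset.prod_pos fun i hi => neg_pos.2 (Finset.mem_filter.1 hi).2
  · exact lt_of_le_of_ne (not_lt.1 (Finset.mem_filter.1 hi).2) (h0 i).symm

theorem ncard_pos_add_ncard_neg {ι : Type*} [Fintype ι] (w : ι → ℝ) :
    {i | 0 < w i}.ncard + {i | w i < 0}.ncard = {i | w i ≠ 0}.ncard := by
  have hd : Disjoint {i | 0 < w i} {i | w i < 0} :=
    Set.disjoint_left.2 fun i (h : 0 < w i) (h' : w i < 0) => lt_asymm h h'
  rw [← Set.ncard_union_eq hd]
  congr 1
  ext i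
  simp only [Set.mem_union, Set.mem_ofPred_eq]
  rw [or_comm]
  exact lt_or_lt_iff_ne

end OfB

end

theorem proposition7 {E : Type*} [AddCommGroup E] [Module ℝ E] [FiniteDimensional ℝ E]
    (B : LinearMap.BilinForm ℝ E) (hB : B.IsSymm) (p q r : ℕ)
    (hsig : OfB.signature B = (p, q, r)) (hpq : 2 ≤ p + q)
    (hne : (p, q, r) ≠ (4, 0, 0) ∧ (p, q, r) ≠ (2, 2, 0) ∧ (p, q, r) ≠ (0, 4, 0)) :
    OfB.IsIndecomposable (OfB.of B) := by
  have : Invertible (2 : ℝ) := invertibleOfNonzero two_ne_zero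
  obtain ⟨b, hb⟩ := LinearMap.BilinForm.exists_orthogonal_basis
    (LinearMap.BilinForm.isSymm_iff.1 hB)
  have hassoc : QuadraticMap.associated (R := ℝ) B.toQuadraticMap = B :=
    QuadraticMap.associated_left_inverse ℝ hB.eq
  have hequiv := QuadraticForm.isometryEquivWeightedSumSquares B.toQuadraticMap b
    (by rw [hassoc]; exact hb)
  have hp : {i | 0 < B (b i) (b i)}.ncard = p :=
    (QuadraticForm.sigPos_of_equiv_weightedSumSquares ⟨hequiv⟩).symm.trans
      (congrArg Prod.fst hsig)
  have hq : {i | B (b i) (b i) < 0}.ncard = q :=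
    (QuadraticForm.sigNeg_of_equiv_weightedSumSquares ⟨hequiv⟩).symm.trans
      (congrArg (fun t => t.2.1) hsig)
  have hr : Module.finrank ℝ (LinearMap.ker B) = r := congrArg (fun t => t.2.2) hsig
  have hn := OfB.ncard_pos_add_ncard_neg fun i => B (b i) (b i)
  rw [hp, hq] at hn
  obtain ⟨i, hi, j, hj, hij⟩ := (Set.one_lt_ncard (Set.toFinite _)).1 (hn ▸ hpq)
  have hgen : LinearMap.ker B = ⊥ → (∀ i, B (b i) (b i) ≠ 0) ∧
      (Fintype.card (Fin (Module.finrank ℝ E)) = 4 → ∏ i, B (b i) (b i) < 0) := by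
    intro hk
    have h0 : ∀ i, B (b i) (b i) ≠ 0 := fun i hi => by
      have h1 : b i ∈ LinearMap.ker B := OfB.mem_ker_of_basis (b := b) fun j => by
        rw [OfB.ortho_apply hb, hi, ite_self]
      rw [hk, Submodule.mem_bot] at h1
      exact b.ne_zero i h1
    refine ⟨h0, fun h4 => OfB.prod_neg_of_odd h0 ?_⟩
    have huniv : {i | B (b i) (b i) ≠ 0} = Set.univ := Set.eq_univ_of_forall h0
    rw [huniv, Set.ncard_univ, Nat.card_eq_fintype_card, h4] at hn
    have hr0 : r = 0 := by rw [← hr, hk, finrank_bot]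
    rw [hq, Nat.odd_iff]
    simp only [hr0, ne_eq, Prod.mk.injEq, and_true] at hne
    -- With p + q = 4 and r = 0, the excluded triples are exactly those with q even.
    lia
  have hnt : Nontrivial (OfB.of B) := by
    refine ⟨⟨OfB.wedgeOf hB (b i) (b j), 0, fun h => ?_⟩⟩
    have h1 := OfB.coeff_wedgeOf hB hb i j i j
    rw [h, map_zero] at h1
    simp only [hij, hij.symm, if_true, if_false, mul_zero, sub_zero] at h1
    exact mul_ne_zero hi hj h1.symm
  exact OfB.isIndecomposable_of_centroid fun P hP hPP =>
    OfB.centroid_idempotent_trivial hB hb hP hPP hgen hij hi hj
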